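/- **Conventions.** Let $k$ be a field and $S$ a finite poset. For a finite poset $Q$, a *$Q$-space* $\mathbf V=(V,V(q))_{q\in Q}$ is a finite-dimensional $k$-vector space $V$ with subspaces $V(q)$ such that $q\le q'$ implies $V(q)\subseteq V(q')$. A morphism $\mathbf U\to\mathbf V$ is a $k$-linear map $f:U\to V$ with $f(U(q))\subseteq V(q)$ for all $q$. It is *proper* if $f(U(q))=V(q)\cap f(U)$ for all $q$. Direct sums are formed componentwise. $\mathbf V$ is *full at $q$* if $V(q)=V$. $\mathbf P$ is *projective* if every morphism $\mathbf P\to\mathbf V$ lifts along every proper epimorphism $\mathbf U\to\mathbf V$. A *projective cover* of $\mathbf V$ is an epimorphism $f:\mathbf P\to\mathbf V$ with $\mathbf P$ projective such that, for every morphism $g:\mathbf X\to\mathbf P$, $g$ is a proper epimorphism if and only if $fg$ is one. For a subposet $T\subseteq Q$: $\operatorname{res}^Q_T$ keeps the ambient space and the subspaces $V(t)$, $t\in T$; $\operatorname{ind}_T^Q$ and $\operatorname{coind}_T^Q$ send a $T$-space $\mathbf V$ to the $Q$-spaces with ambient space $V$ and with subspaces $\sum_{t\in T,\,t\le q}V(t)$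 and $\bigcap_{t\in T,\,q\le t}V(t)$, respectively (an empty intersection is $V$). On morphisms all three keep the linear map. For $p\in Q$, $E^p\mathbf V$ has ambient space $V(p)$ and subspaces $V(q)\cap V(p)$, with inclusion $\kappa_p(\mathbf V):E^p\mathbf V\to\mathbf V$; and $E_p\mathbf V$ has ambient space $V/V(p)$ and subspaces $(V(q)+V(p))/V(p)$, a functor in the obvious way. A *filter* is an up-closed subset. The width $w(Q)$ is the largest cardinality of an antichain of $Q$. $\hat a(Q)$ is the poset of nonempty antichains of $Q$, with $A\le B$ if and only if every $b\in B$ satisfies $a\le b$ for some $a\in A$; an element $q$ is identified with $\{q\}$. For $R\subseteq S$, $S_R=R\cup\hat a(S\setminus R)$ as a subposet of $\hat a(S)$, so that $S\subseteq S_R$. **Proposition 5.5.** Let $R$ be a filter of $S$ with $w(S\setminus R)\le 2$, let $F$ be a filter of $S_R$ that does not contain $R$, and let $p\in R\setminus F$. Let $D=\operatorname{res}^{S_R}_F\,E_p\,\operatorname{coind}_S^{S_R}$, a functor from $S$-spaces to $F$-spaces. For an $F$-space $\mathbf W$, let $$f:\mathbf P\to \operatorname{res}^{S_R}_{\hat a(S\setminus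 R)}\operatorname{ind}_F^{S_R}\mathbf W$$ be a proper epimorphism of $\hat a(S\setminus R)$-spaces with $\mathbf P$ projective. Let $\mathbf P_f$ be the family with ambient space $P$, with the subspaces $P(t)$ for $t\in\hat a(S\setminus R)$, and with, for $t\in R$, the inverse image under $f$ of the subspace of $\operatorname{ind}_F^{S_R}\mathbf W$ at $t$. (a) $\mathbf P_f$ is an $S_R$-space with $\operatorname{res}^{S_R}_{\hat a(S\setminus R)}\mathbf P_f=\mathbf P$, and the linear map $f$ gives a proper epimorphism $\hat f:\mathbf P_f\to\operatorname{ind}_F^{S_R}\mathbf W$ with $\operatorname{res}^{S_R}_{\hat a(S\setminus R)}\hat f=f$. Moreover, $\operatorname{Ker}\hat f=E^p\mathbf P_f$, that is, $\kappa_p(\mathbf P_f)$ is a kernel of $\hat f$; and $\hat f$ is a cokernel of $\kappa_p(\mathbf P_f)$. (b) There is an $S$-space $\mathbf V$, unique up to isomorphism, with $\mathbf P_f\cong\operatorname{coind}_S^{S_R}\mathbf V$, and it satisfies $\mathbf W\cong D\mathbf V$. (c) For every morphism $\alpha:\mathbf U\to\mathbf V$ of $S$-spaces, $D\alpha=0$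 if and only if $\alpha$ factors through an $S$-space full at $p$. (d) The morphism $f$ is a projective cover if and only if the $S$-space $\mathbf V$ of (b) has no nonzero direct summand full at $p$. The functor $D$ is additive, and its restriction to the full subcategory of the $S$-spaces with no nonzero direct summand full at $p$ is dense: every $F$-space is isomorphic to $D\mathbf V$ for some $\mathbf V$ in that subcategory. -/

import Mathlib

open CategoryTheory

universe u v w

namespace PosetRep

/-! ### Posets of antichains -/

/-- The width of a poset: the largest cardinality of an antichain. -/
noncomputable def width (S : Type v) [PartialOrder S] : ℕ∞ :=
  ⨆ A : {A : Set S // IsAntichain (· ≤ ·) A}, A.1.encard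

/-- The set of nonempty antichains of `S`. -/
@[ext]
structure AHat (S : Type v) [PartialOrder S] where
  /-- the underlying set of the antichain -/
  carrier : Set S
  isAntichain : IsAntichain (· ≤ ·) carrier
  nonempty : carrier.Nonempty

/-- The order on nonempty antichains: `A ≤ B` iff every element of `B` lies above some element
of `A`. With it, the antichain `{a₁, …, aₘ}` is the meet of the `{aᵢ}`. -/
instance AHat.instPartialOrder (S : Type v) [PartialOrder S] : PartialOrder (AHat S) where
  le A B := ∀ b ∈ B.carrier, ∃ a ∈ A.carrier, a ≤ b
  le_refl A := fun b hb => ⟨b, hb, le_rfl⟩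
  le_trans A B C hAB hBC := fun c hc => by
    obtain ⟨b, hb, hbc⟩ := hBC c hc
    obtain ⟨a, ha, hab⟩ := hAB b hb
    exact ⟨a, ha, hab.trans hbc⟩
  le_antisymm A B hAB hBA := by
    have key : ∀ A B : AHat S, (∀ b ∈ B.carrier, ∃ a ∈ A.carrier, a ≤ b) →
        (∀ a ∈ A.carrier, ∃ b ∈ B.carrier, b ≤ a) → B.carrier ⊆ A.carrier := by
      intro A B h1 h2 b hb
      obtain ⟨a, ha, hab⟩ := h1 b hb
      obtain ⟨b', hb', hba⟩ := h2 a ha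
      have hbb : b' = b := B.isAntichain.eq hb' hb (hba.trans hab)
      have hE : a = b := le_antisymm hab (hbb ▸ hba)
      exact hE ▸ ha
    exact AHat.ext (Set.Subset.antisymm (key B A hBA hAB) (key A B hAB hBA))

/-- The antichain `{s}`. -/
def AHat.single {S : Type v} [PartialOrder S] (s : S) : AHat S where
  carrier := {s}
  isAntichain := Set.subsingleton_singleton.isAntichain _
  nonempty := Set.singleton_nonempty s

theorem AHat.single_le_single {S : Type v} [PartialOrder S] {s t : S} :
    AHat.single s ≤ AHat.single t ↔ s ≤ t := by
  change (∀ b ∈ ({t} : Set S), ∃ a ∈ ({s} : Set S), a ≤ b) ↔ s ≤ t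
  simp

/-- An antichain of a subset of `S` is an antichain of `S`. -/
def AHat.ofSubset {S : Type v} [PartialOrder S] (T : Set S) (A : AHat T) : AHat S where
  carrier := Subtype.val '' A.carrier
  isAntichain := by
    rintro _ ⟨a, ha, rfl⟩ _ ⟨b, hb, rfl⟩ hne hab
    exact hne (congrArg Subtype.val (A.isAntichain.eq ha hb hab))
  nonempty := A.nonempty.image _

theorem AHat.ofSubset_le_ofSubset {S : Type v} [PartialOrder S] {T : Set S} {A B : AHat T} :
    AHat.ofSubset T A ≤ AHat.ofSubset T B ↔ A ≤ B := by
  change (∀ b ∈ Subtype.val '' B.carrier, ∃ a ∈ Subtype.val '' A.carrier, a ≤ b) ↔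
    (∀ b ∈ B.carrier, ∃ a ∈ A.carrier, a ≤ b)
  constructor
  · intro h b hb
    obtain ⟨_, ⟨a, ha, rfl⟩, hab⟩ := h b ⟨b, hb, rfl⟩
    exact ⟨a, ha, hab⟩
  · rintro h _ ⟨b, hb, rfl⟩
    obtain ⟨a, ha, hab⟩ := h b hb
    exact ⟨a, ⟨a, ha, rfl⟩, hab⟩

/-- The set `S_R = R ∪ â(S ∖ R)`. -/
inductive Enl {S : Type v} [PartialOrder S] (R : Set S) : Type v
  | pt (r : R) : Enl R
  | ac (A : AHat (Rᶜ : Set S)) : Enl R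

namespace Enl

variable {S : Type v} [PartialOrder S] (R : Set S)

/-- The inclusion of `S_R` in `â(S)`. -/
def toAHat : Enl R → AHat S
  | pt r => AHat.single r.1
  | ac A => AHat.ofSubset Rᶜ A

theorem toAHat_injective : Function.Injective (toAHat R) := by
  have key : ∀ (r : R) (A : AHat (Rᶜ : Set S)),
      AHat.single r.1 ≠ AHat.ofSubset Rᶜ A := by
    intro r A h
    obtain ⟨a, ha⟩ := A.nonempty
    have h1 : a.1 ∈ (AHat.ofSubset Rᶜ A).carrier := ⟨a, ha, rfl⟩
    rw [← h] at h1
    have h2 : a.1 = r.1 := h1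
    exact a.2 (h2 ▸ r.2)
  rintro (r | A) (r' | B) h
  · exact congrArg pt (Subtype.ext (le_antisymm (AHat.single_le_single.1 (le_of_eq h))
      (AHat.single_le_single.1 (ge_of_eq h))))
  · exact (key r B h).elim
  · exact (key r' A h.symm).elim
  · exact congrArg ac (le_antisymm (AHat.ofSubset_le_ofSubset.1 (le_of_eq h))
      (AHat.ofSubset_le_ofSubset.1 (ge_of_eq h)))

/-- `S_R` is a subposet of `â(S)`. -/
instance instPartialOrder : PartialOrder (Enl R) :=
  PartialOrder.lift (toAHat R) (toAHat_injective R)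

/-- The inclusion `â(S ∖ R) ⊆ S_R`. -/
def acEmb : AHat (Rᶜ : Set S) ↪o Enl R where
  toFun := ac
  inj' _ _ h := by injection h
  map_rel_iff' := AHat.ofSubset_le_ofSubset

open Classical in
/-- The map `S → S_R`, `s ↦ s`, where `s ∈ S ∖ R` is identified with the antichain `{s}`. -/
noncomputable def ofPt (s : S) : Enl R :=
  if h : s ∈ R then pt ⟨s, h⟩ else ac (AHat.single ⟨s, h⟩)

theorem toAHat_ofPt (s : S) : toAHat R (ofPt R s) = AHat.single s := by
  unfold ofPt
  split_ifs with h
  · rfl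
  · exact AHat.ext (Set.image_singleton)

/-- The inclusion `S ⊆ S_R`. -/
noncomputable def ptEmb : S ↪o Enl R :=
  OrderEmbedding.ofMapLEIff (ofPt R) fun s t => by
    change toAHat R (ofPt R s) ≤ toAHat R (ofPt R t) ↔ s ≤ t
    rw [toAHat_ofPt, toAHat_ofPt, AHat.single_le_single]

end Enl

/-! ### The category of `S`-spaces -/

/-- An `S`-space over the field `k`: a finite dimensional vector space with a monotone family of
subspaces indexed by the poset `S`. -/
structure PSpace (k : Type u) [Field k] (S : Type v) [PartialOrder S] where
  /-- the ambient space -/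
  carrier : Type u
  [addCommGroup : AddCommGroup carrier]
  [module : Module k carrier]
  [finite : FiniteDimensional k carrier]
  /-- the subspaces -/
  sub : S → Submodule k carrier
  mono : Monotone sub

attribute [instance] PSpace.addCommGroup PSpace.module PSpace.finite

namespace PSpace

variable {k : Type u} [Field k] {S : Type v} [PartialOrder S]

/-- The space of morphisms `U ⟶ V`: the linear maps `f` with `f (U s) ⊆ V s` for all `s`. -/
def homs (U V : PSpace k S) : Submodule k (U.carrier →ₗ[k] V.carrier) where
  carrier := {f | ∀ s, ∀ x ∈ U.sub s, f x ∈ V.sub s}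
  add_mem' hf hg := fun s x hx => (V.sub s).add_mem (hf s x hx) (hg s x hx)
  zero_mem' := fun s _ _ => (V.sub s).zero_mem
  smul_mem' c _ hf := fun s x hx => (V.sub s).smul_mem c (hf s x hx)

instance instCategory : Category (PSpace k S) where
  Hom U V := homs U V
  id U := ⟨LinearMap.id, fun _ _ hx => hx⟩
  comp f g := ⟨g.1 ∘ₗ f.1, fun s x hx => g.2 s _ (f.2 s x hx)⟩

/-- The linear map underlying a morphism. -/
def lin {U V : PSpace k S} (f : U ⟶ V) : U.carrier →ₗ[k] V.carrier := Subtype.val f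

theorem lin_mem {U V : PSpace k S} (f : U ⟶ V) {s : S} {x : U.carrier} (hx : x ∈ U.sub s) :
    lin f x ∈ V.sub s := Subtype.property f s x hx

/-- The morphism given by a linear map that respects the subspaces. -/
def mkHom {U V : PSpace k S} (f : U.carrier →ₗ[k] V.carrier)
    (hf : ∀ s, ∀ x ∈ U.sub s, f x ∈ V.sub s) : U ⟶ V := ⟨f, hf⟩

theorem hom_ext {U V : PSpace k S} {f g : U ⟶ V} (h : lin f = lin g) : f = g := Subtype.ext h

instance instHomAddCommGroup (U V : PSpace k S) : AddCommGroup (U ⟶ V) :=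
  inferInstanceAs (AddCommGroup (homs U V))

theorem lin_comp {U V W : PSpace k S} (f : U ⟶ V) (g : V ⟶ W) : lin (f ≫ g) = lin g ∘ₗ lin f :=
  rfl

theorem lin_add {U V : PSpace k S} (f g : U ⟶ V) : lin (f + g) = lin f + lin g := rfl

instance instPreadditive : Preadditive (PSpace k S) where
  add_comp _ _ _ f f' g := hom_ext <| by
    rw [lin_comp, lin_add, lin_add, LinearMap.comp_add, lin_comp, lin_comp]
  comp_add _ _ _ f g g' := hom_ext <| by
    rw [lin_comp, lin_add, lin_add, LinearMap.add_comp, lin_comp, lin_comp]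

/-- The direct sum of two `S`-spaces. -/
def directSum (U V : PSpace k S) : PSpace k S where
  carrier := U.carrier × V.carrier
  sub s := (U.sub s).prod (V.sub s)
  mono _ _ h := Submodule.prod_mono (U.mono h) (V.mono h)

/-- `X` is (isomorphic to) a direct summand of `V`. -/
def IsDirectSummand (X V : PSpace k S) : Prop := ∃ Y : PSpace k S, Nonempty (V ≅ X.directSum Y)

/-- `V` is full at `t`. -/
def FullAt (V : PSpace k S) (t : S) : Prop := V.sub t = ⊤

/-- The `S`-spaces with no nonzero direct summand full at `p`. -/
def noFullSummand (p : S) : ObjectProperty (PSpace k S) :=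
  fun V => ∀ X : PSpace k S, X.IsDirectSummand V → X.FullAt p → Limits.IsZero X

/-- The morphism `α` factors through an `S`-space that is full at `p`. -/
def FactorsThroughFullAt {U V : PSpace k S} (α : U ⟶ V) (p : S) : Prop :=
  ∃ X : PSpace k S, X.FullAt p ∧ ∃ (γ : U ⟶ X) (β : X ⟶ V), γ ≫ β = α

/-- Proper morphisms: `f (U s) = V s ∩ f U` for all `s`. -/
def IsProper {U V : PSpace k S} (f : U ⟶ V) : Prop :=
  ∀ s, (U.sub s).map (lin f) = V.sub s ⊓ LinearMap.range (lin f)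

/-- Proper epimorphisms. -/
def IsProperEpi {U V : PSpace k S} (f : U ⟶ V) : Prop := Epi f ∧ IsProper f

/-- (Relatively) projective `S`-spaces. -/
def IsProjective (P : PSpace k S) : Prop :=
  ∀ (U V : PSpace k S) (f : U ⟶ V), IsProperEpi f → ∀ h : P ⟶ V, ∃ g : P ⟶ U, g ≫ f = h

/-- Essential epimorphisms. -/
def IsEssentialEpi {U V : PSpace k S} (f : U ⟶ V) : Prop :=
  Epi f ∧ ∀ (X : PSpace k S) (g : X ⟶ U), IsProperEpi g ↔ IsProperEpi (g ≫ f)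

/-- Projective covers. -/
def IsProjectiveCover {P V : PSpace k S} (f : P ⟶ V) : Prop :=
  P.IsProjective ∧ IsEssentialEpi f

/-! ### Restriction, induction, coinduction -/

variable {T : Type w} [PartialOrder T]

/-- Restriction to a subposet `T` of `S`, given by its inclusion `e`. -/
def res (e : T ↪o S) : PSpace k S ⥤ PSpace k T where
  obj V :=
    { carrier := V.carrier
      sub := fun t => V.sub (e t)
      mono := fun _ _ h => V.mono (e.monotone h) }
  map {V W} f := mkHom (lin (U := V) (V := W) f) fun _ _ hx => lin_mem (U := V) (V := W) f hx

/-- Induction from a subposet `T` of `S`: the subspace at `s` is the sum of the `V t` over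
`t ∈ T`, `t ≤ s`. -/
def ind (e : T ↪o S) : PSpace k T ⥤ PSpace k S where
  obj V :=
    { carrier := V.carrier
      sub := fun s => ⨆ (t : T) (_ : e t ≤ s), V.sub t
      mono := fun _ _ h => iSup_mono fun _ => iSup_le fun ht =>
        le_iSup_of_le (ht.trans h) le_rfl }
  map {V W} f := mkHom (lin (U := V) (V := W) f) fun s x hx => by
    have h : (⨆ (t : T) (_ : e t ≤ s), V.sub t) ≤
        (⨆ (t : T) (_ : e t ≤ s), W.sub t).comap (lin f) :=
      iSup₂_le fun t ht y hy =>
        (le_iSup₂ (f := fun (t : T) (_ : e t ≤ s) => W.sub t) t ht) (lin_mem f hy)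
    exact h hx

/-- Coinduction from a subposet `T` of `S`: the subspace at `s` is the intersection of the `V t`
over `t ∈ T`, `s ≤ t`. -/
def coind (e : T ↪o S) : PSpace k T ⥤ PSpace k S where
  obj V :=
    { carrier := V.carrier
      sub := fun s => ⨅ (t : T) (_ : s ≤ e t), V.sub t
      mono := fun _ _ h => iInf_mono fun _ => le_iInf fun ht =>
        iInf_le_of_le (h.trans ht) le_rfl }
  map {V W} f := mkHom (lin (U := V) (V := W) f) fun s x hx => by
    simp only [Submodule.mem_iInf] at hx ⊢
    exact fun t ht => lin_mem f (hx t ht)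

/-! ### The functors `E^p` and `E_p` -/

/-- `E^p V` has the ambient space `V p` and the subspaces `V s ∩ V p`. -/
def ESup (p : S) : PSpace k S ⥤ PSpace k S where
  obj V :=
    { carrier := V.sub p
      sub := fun s => (V.sub s).comap (V.sub p).subtype
      mono := fun _ _ h => Submodule.comap_mono (V.mono h) }
  map f := mkHom ((lin f).restrict fun _ hx => lin_mem f hx) fun _ _ hx => lin_mem f hx

/-- The inclusion `κ_p : E^p V ⟶ V`. -/
def kappa (p : S) (V : PSpace k S) : (ESup p).obj V ⟶ V :=
  mkHom (V.sub p).subtype fun _ _ hx => hx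

/-- `E_p V` has the ambient space `V / V p` and the subspaces `(V s + V p) / V p`. -/
def ESub (p : S) : PSpace k S ⥤ PSpace k S where
  obj V :=
    { carrier := V.carrier ⧸ V.sub p
      sub := fun s => (V.sub s).map (V.sub p).mkQ
      mono := fun _ _ h => Submodule.map_mono (V.mono h) }
  map {V W} f := mkHom ((V.sub p).mapQ (W.sub p) (lin f) fun _ hx => lin_mem f hx) fun s x hx => by
    obtain ⟨y, hy, rfl⟩ := hx
    exact ⟨lin f y, lin_mem f hy, rfl⟩
  map_id V := hom_ext (Submodule.linearMap_qext _ rfl)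
  map_comp f g := hom_ext (Submodule.linearMap_qext _ rfl)

/-! ### The lift of a morphism from `â(S ∖ R)` to `S_R` -/

/-- For a filter `R` of `S`, an `S_R`-space `V` and a morphism `f` from an `â(S ∖ R)`-space `P` to
the restriction of `V`, the `S_R`-space `P_f` with the ambient space of `P`, the subspaces of `P`
at the elements of `â(S ∖ R)` and the inverse images of the subspaces of `V` at the elements
of `R`. -/
def liftSpace {R : Set S} (hR : IsUpperSet R) {P : PSpace k (AHat (Rᶜ : Set S))}
    {V : PSpace k (Enl R)} (f : P ⟶ (res (Enl.acEmb R)).obj V) : PSpace k (Enl R) where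
  carrier := P.carrier
  sub
    | Enl.pt r => (V.sub (Enl.pt r)).comap (lin f)
    | Enl.ac A => P.sub A
  mono := by
    rintro (r | A) (r' | B) h
    · exact Submodule.comap_mono (V.mono h)
    · obtain ⟨b, hb⟩ := B.nonempty
      obtain ⟨a, ha, hab⟩ := h b.1 ⟨b, hb, rfl⟩
      have hE : a = r.1 := ha
      exact (b.2 (hR hab (hE ▸ r.2))).elim
    · intro x hx
      exact V.mono h (lin_mem f hx)
    · exact P.mono (AHat.ofSubset_le_ofSubset.1 h)

end PSpace

/-- The inclusion of a subset `F` of a poset. -/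
def incl {T : Type v} [PartialOrder T] (F : Set T) : F ↪o T := OrderEmbedding.subtype (· ∈ F)

/-- The functor `res_F E_p coind` from `S`-spaces to `F`-spaces, for `F ⊆ S_R` and `p ∈ R`. -/
noncomputable def diffFunctor (k : Type u) [Field k] {S : Type v} [PartialOrder S] {R : Set S}
    (F : Set (Enl R)) (p : R) : PSpace k S ⥤ PSpace k F :=
  PSpace.coind (Enl.ptEmb R) ⋙ PSpace.ESub (Enl.pt p) ⋙ PSpace.res (incl F)

end PosetRep

open PosetRep PosetRep.PSpace

namespace PosetRep.PSpace

/-! ### Morphisms, proper epimorphisms, projectives and idempotents -/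

section General

variable {k : Type u} [Field k] {S : Type v} [PartialOrder S]

/-! Since `F` is a filter that misses `p`, the space induced from `W` is zero at `p`. Hence the
subspace of `P_f` at `p` is the inverse image of zero, that is, the kernel of `f`. The lifted map is
therefore a proper epimorphism with kernel `P_f(p)`, which makes it the projection of `P_f` onto
`E_p P_f` and gives the kernel and cokernel statements.

Projectivity makes `P_f` coinduced from `S`. In a free space, the subspace at a meet is the
intersection of the subspaces, and this passes to retracts, hence to projectives
(`IsProjective.mem_sub_of_isGLB`). An antichain is the meet of its elements, so `P_f` is determined
by its subspaces at points of `S`. Restricting it to `S` gives `V`. Then `D V` is the restriction to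
`F` of `E_p P_f`, which is the space induced from `W`; so `D V` is `W`.

A morphism `α` into `V` is killed by `D` exactly when its image lies in `V(p)`, that is, when it
factors through `E^p V`.

For projective covers, both sides become statements about idempotents. By Fitting's lemma, `f` is a
projective cover if and only if no nonzero idempotent of `P` is killed by `f`
(`isProjectiveCover_iff`). The absence of summands of `V` full at `p` says that no nonzero
idempotent of `V` has its image in `V(p)`. As `V(p)` is the kernel of `f`, these are the same linear
maps. Density follows because `D` kills summands full at `p`, so they can be split off. -/

@[simp] theorem lin_comp_apply {U V W : PSpace k S} (f : U ⟶ V) (g : V ⟶ W) (x : U.carrier) :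
    lin (f ≫ g) x = lin g (lin f x) := rfl

theorem hom_ext_apply {U V : PSpace k S} {f g : U ⟶ V} (h : ∀ x, lin f x = lin g x) : f = g :=
  hom_ext (LinearMap.ext h)

theorem lin_congr {U V : PSpace k S} {f g : U ⟶ V} (h : f = g) (x : U.carrier) :
    lin f x = lin g x := by rw [h]

/-- A linear equivalence that matches the subspaces is an isomorphism of `S`-spaces. -/
def isoOfEquiv {U V : PSpace k S} (φ : U.carrier ≃ₗ[k] V.carrier)
    (h : ∀ s x, x ∈ U.sub s ↔ φ x ∈ V.sub s) : U ≅ V where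
  hom := mkHom φ.toLinearMap fun s x hx => (h s x).1 hx
  inv := mkHom φ.symm.toLinearMap fun s x hx => (h s _).2 (by simpa using hx)
  hom_inv_id := hom_ext_apply fun x => φ.symm_apply_apply x
  inv_hom_id := hom_ext_apply fun x => φ.apply_symm_apply x

/-- The cokernel with all its subspaces full receives the quotient map as a morphism, so an
epimorphism forces that map to be zero. -/
theorem surjective_of_epi {U V : PSpace k S} (f : U ⟶ V) [Epi f] :
    Function.Surjective (lin f) := by
  let Q : PSpace k S :=
    { carrier := V.carrier ⧸ LinearMap.range (lin f)
      sub := fun _ => ⊤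
      mono := fun _ _ _ => le_rfl }
  let q : V ⟶ Q := mkHom (LinearMap.range (lin f)).mkQ fun _ _ _ => Submodule.mem_top
  have hq : q = 0 := (cancel_epi f).1 <| hom_ext_apply fun x =>
    (Submodule.Quotient.mk_eq_zero _).2 ⟨x, rfl⟩
  intro y
  exact (Submodule.Quotient.mk_eq_zero _).1 (lin_congr hq y)

theorem epi_of_surjective {U V : PSpace k S} (f : U ⟶ V) (hf : Function.Surjective (lin f)) :
    Epi f where
  left_cancellation g h hgh := hom_ext_apply fun y => by
    obtain ⟨x, rfl⟩ := hf y
    exact lin_congr hgh x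

theorem isProperEpi_iff {U V : PSpace k S} {f : U ⟶ V} :
    IsProperEpi f ↔ Function.Surjective (lin f) ∧
      ∀ s, ∀ y ∈ V.sub s, ∃ x ∈ U.sub s, lin f x = y := by
  constructor
  · rintro ⟨he, hp⟩
    have hs := surjective_of_epi f
    refine ⟨hs, fun s y hy => ?_⟩
    have : y ∈ (U.sub s).map (lin f) := by
      rw [hp s]
      exact ⟨hy, hs y⟩
    exact this
  · rintro ⟨hs, hp⟩
    refine ⟨epi_of_surjective f hs, fun s => le_antisymm ?_ ?_⟩
    · rintro _ ⟨x, hx, rfl⟩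
      exact ⟨lin_mem f hx, x, rfl⟩
    · rintro y ⟨hy, -⟩
      exact hp s y hy

theorem IsProperEpi.comp {U V W : PSpace k S} {g : U ⟶ V} {f : V ⟶ W} (hg : IsProperEpi g)
    (hf : IsProperEpi f) : IsProperEpi (g ≫ f) := by
  rw [isProperEpi_iff] at *
  refine ⟨hf.1.comp hg.1, fun s z hz => ?_⟩
  obtain ⟨y, hy, rfl⟩ := hf.2 s z hz
  obtain ⟨x, hx, rfl⟩ := hg.2 s y hy
  exact ⟨x, hx, rfl⟩

theorem IsProperEpi.of_comp_id {U V : PSpace k S} {i : V ⟶ U} {g : U ⟶ V} (h : i ≫ g = 𝟙 V) :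
    IsProperEpi g :=
  isProperEpi_iff.2 ⟨fun y => ⟨lin i y, lin_congr h y⟩,
    fun _ y hy => ⟨lin i y, lin_mem i hy, lin_congr h y⟩⟩

theorem isZero_iff (X : PSpace k S) : Limits.IsZero X ↔ Subsingleton X.carrier := by
  constructor
  · intro h
    have h0 : 𝟙 X = 0 := h.eq_of_src _ _
    exact ⟨fun x y => (lin_congr h0 x).trans (lin_congr h0 y).symm⟩
  · intro h
    exact ⟨fun Y => ⟨⟨⟨0⟩, fun f => hom_ext_apply fun x => by
        rw [Subsingleton.elim x 0, map_zero, map_zero]⟩⟩,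
      fun Y => ⟨⟨⟨0⟩, fun f => hom_ext_apply fun x => Subsingleton.elim _ _⟩⟩⟩

/-! ### Free covers -/

/-- The free `S`-space on the subspaces of `V` and on its ambient space, for an enumeration `e`
of `S`. -/
def freeCover (V : PSpace k S) {n : ℕ} (e : Fin n ≃ S) : PSpace k S where
  carrier := (∀ i : Fin n, V.sub (e i)) × V.carrier
  sub s :=
    { carrier := {x | x.2 = 0 ∧ ∀ i, ¬ e i ≤ s → x.1 i = 0}
      add_mem' := fun {x y} hx hy => ⟨by simp [hx.1, hy.1], fun i hi => by
        simp [hx.2 i hi, hy.2 i hi]⟩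
      zero_mem' := ⟨rfl, fun _ _ => rfl⟩
      smul_mem' := fun c x hx => ⟨by simp [hx.1], fun i hi => by simp [hx.2 i hi]⟩ }
  mono := fun _ _ h _ hx => ⟨hx.1, fun i hi => hx.2 i fun hs => hi (hs.trans h)⟩

theorem mem_freeCover {V : PSpace k S} {n : ℕ} {e : Fin n ≃ S} {s : S}
    {x : (V.freeCover e).carrier} :
    x ∈ (V.freeCover e).sub s ↔ x.2 = 0 ∧ ∀ i, ¬ e i ≤ s → x.1 i = 0 := Iff.rfl

/-- The linear map on the ambient space of the free `S`-space given by a family of linear maps into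
the subspaces of `U`, and one into its ambient space. -/
def freeSum {V U : PSpace k S} {n : ℕ} (e : Fin n ≃ S)
    (a : ∀ i, V.sub (e i) →ₗ[k] U.sub (e i)) (b : V.carrier →ₗ[k] U.carrier) :
    (∀ i : Fin n, V.sub (e i)) × V.carrier →ₗ[k] U.carrier :=
  (∑ i, (U.sub (e i)).subtype ∘ₗ a i ∘ₗ LinearMap.proj i).coprod b

theorem freeSum_apply {V U : PSpace k S} {n : ℕ} (e : Fin n ≃ S)
    (a : ∀ i, V.sub (e i) →ₗ[k] U.sub (e i)) (b : V.carrier →ₗ[k] U.carrier)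
    (x : (∀ i : Fin n, V.sub (e i)) × V.carrier) :
    freeSum e a b x = ∑ i, (a i (x.1 i) : U.carrier) + b x.2 := by
  simp [freeSum, LinearMap.coprod_apply]

/-- A family of linear maps into the subspaces of `U`, and one into its ambient space, define a
morphism from the free `S`-space. -/
def freeDesc {V U : PSpace k S} {n : ℕ} (e : Fin n ≃ S)
    (a : ∀ i, V.sub (e i) →ₗ[k] U.sub (e i)) (b : V.carrier →ₗ[k] U.carrier) :
    V.freeCover e ⟶ U :=
  mkHom (freeSum e a b) fun s x hx => by
    obtain ⟨h2, h1⟩ := mem_freeCover.1 hx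
    have hmem : ∑ i, (a i (x.1 i) : U.carrier) + b x.2 ∈ U.sub s := by
      rw [h2, map_zero, add_zero]
      refine Submodule.sum_mem _ fun i _ => ?_
      by_cases hi : e i ≤ s
      · exact U.mono hi (a i (x.1 i)).2
      · simp [h1 i hi]
    exact (freeSum_apply e a b x).symm ▸ hmem

/-- The canonical morphism from the free cover. -/
def freeCoverHom (V : PSpace k S) {n : ℕ} (e : Fin n ≃ S) : V.freeCover e ⟶ V :=
  freeDesc e (fun _ => LinearMap.id) LinearMap.id

theorem single_mem_freeCover (V : PSpace k S) {n : ℕ} (e : Fin n ≃ S) (i : Fin n)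
    (x : V.sub (e i)) :
    ((Pi.single i x, 0) : (V.freeCover e).carrier) ∈ (V.freeCover e).sub (e i) := by
  refine mem_freeCover.2 ⟨rfl, fun j hj => ?_⟩
  have : j ≠ i := by
    rintro rfl
    exact hj le_rfl
  simp [this]

theorem isProperEpi_freeCoverHom (V : PSpace k S) {n : ℕ} (e : Fin n ≃ S) :
    IsProperEpi (V.freeCoverHom e) := by
  refine isProperEpi_iff.2 ⟨fun y => ⟨(0, y), ?_⟩, fun s y hy => ?_⟩
  · refine (freeSum_apply e _ _ _).trans ?_
    simp
  · obtain ⟨j, rfl⟩ := e.surjective s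
    refine ⟨_, single_mem_freeCover V e j ⟨y, hy⟩, (freeSum_apply e _ _ _).trans ?_⟩
    rw [Finset.sum_eq_single j]
    · simp
    · intro i _ hi
      simp [hi]
    · simp

/-- A lift is chosen on each summand separately: properness makes each map `A(e i) → B(e i)`
surjective, and linear maps lift along surjections. -/
theorem isProjective_freeCover (V : PSpace k S) {n : ℕ} (e : Fin n ≃ S) :
    (V.freeCover e).IsProjective := by
  intro A B f hf h
  rw [isProperEpi_iff] at hf
  let H : (∀ i : Fin n, V.sub (e i)) × V.carrier →ₗ[k] B.carrier := lin h
  have ha : ∀ i, ∃ a : V.sub (e i) →ₗ[k] A.sub (e i), ∀ x,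
      lin f (a x) = H (Pi.single i x, 0) := by
    intro i
    let hi : V.sub (e i) →ₗ[k] B.sub (e i) :=
      (H ∘ₗ LinearMap.inl k _ _ ∘ₗ LinearMap.single k _ i).codRestrict _
        fun x => lin_mem h (single_mem_freeCover V e i x)
    let fi : A.sub (e i) →ₗ[k] B.sub (e i) := (lin f).restrict fun _ hx => lin_mem f hx
    have hfi : Function.Surjective fi := fun y => by
      obtain ⟨x, hx, hxy⟩ := hf.2 _ y.1 y.2
      exact ⟨⟨x, hx⟩, Subtype.ext hxy⟩
    obtain ⟨a, ha⟩ := Module.projective_lifting_property fi hi hfi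
    exact ⟨a, fun x => congrArg Subtype.val (LinearMap.congr_fun ha x)⟩
  choose a ha using ha
  obtain ⟨b, hb⟩ := Module.projective_lifting_property (lin f)
    (H ∘ₗ LinearMap.inr k (∀ i : Fin n, V.sub (e i)) V.carrier) hf.1
  have key : ∀ x, lin f (freeSum e a b x) = H x := fun x => by
    have hx : x = ∑ i, ((Pi.single i (x.1 i), 0) : (∀ i : Fin n, V.sub (e i)) × V.carrier) +
        (0, x.2) := by
      refine Prod.ext ?_ ?_
      · rw [Prod.fst_add, Prod.fst_sum, add_zero]
        exact (Finset.univ_sum_single x.1).symm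
      · simp [Prod.snd_sum]
    rw [freeSum_apply, map_add, map_sum]
    conv_rhs => rw [hx, map_add, map_sum]
    exact congrArg₂ _ (Finset.sum_congr rfl fun i _ => ha i _) (LinearMap.congr_fun hb x.2)
  exact ⟨freeDesc e a b, hom_ext_apply key⟩

theorem exists_projective_properEpi [Finite S] (V : PSpace k S) :
    ∃ (P : PSpace k S) (f : P ⟶ V), P.IsProjective ∧ IsProperEpi f := by
  obtain ⟨n, ⟨e⟩⟩ := Finite.exists_equiv_fin S
  exact ⟨_, _, isProjective_freeCover V e.symm, isProperEpi_freeCoverHom V e.symm⟩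

/-- In a projective space, the subspace at a meet is the intersection of the subspaces. -/
theorem IsProjective.mem_sub_of_isGLB [Finite S] {P : PSpace k S} (hP : P.IsProjective)
    {T : Set S} (hT : T.Nonempty) {s : S} (hs : IsGLB T s) {x : P.carrier}
    (hx : ∀ t ∈ T, x ∈ P.sub t) : x ∈ P.sub s := by
  obtain ⟨n, ⟨e'⟩⟩ := Finite.exists_equiv_fin S
  let e := e'.symm
  -- Projectivity splits the free cover, so membership can be tested in the free space through the
  -- section `i`.
  obtain ⟨i, hi⟩ := hP _ _ _ (isProperEpi_freeCoverHom P e) (𝟙 P)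
  have hix : lin i x ∈ (P.freeCover e).sub s := by
    refine mem_freeCover.2 ⟨?_, fun j hj => ?_⟩
    -- The ambient summand lies in no subspace; one element of `T` suffices to kill its coordinate.
    · obtain ⟨t, ht⟩ := hT
      exact (mem_freeCover.1 (lin_mem i (hx t ht))).1
    · by_contra hne
      refine hj (hs.2 fun t ht => ?_)
      by_contra hjt
      exact hne ((mem_freeCover.1 (lin_mem i (hx t ht))).2 j hjt)
  have := lin_mem (P.freeCoverHom e) hix
  rwa [← lin_comp_apply, hi] at this

/-! ### Direct summands and idempotents -/

theorem IsDirectSummand.of_iso {X V V' : PSpace k S} (h : X.IsDirectSummand V) (φ : V' ≅ V) :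
    X.IsDirectSummand V' := by
  obtain ⟨Y, ⟨ψ⟩⟩ := h
  exact ⟨Y, ⟨φ ≪≫ ψ⟩⟩

theorem noFullSummand_congr {V V' : PSpace k S} (φ : V ≅ V') (p : S) :
    noFullSummand p V ↔ noFullSummand p V' :=
  ⟨fun h X hX => h X (hX.of_iso φ), fun h X hX => h X (hX.of_iso φ.symm)⟩

/-- The first inclusion into a direct sum. -/
def inl (X Y : PSpace k S) : X ⟶ X.directSum Y :=
  mkHom (LinearMap.inl k _ _) fun _ _ hx => ⟨hx, Submodule.zero_mem _⟩

/-- The second inclusion into a direct sum. -/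
def inr (X Y : PSpace k S) : Y ⟶ X.directSum Y :=
  mkHom (LinearMap.inr k _ _) fun _ _ hx => ⟨Submodule.zero_mem _, hx⟩

/-- The first projection from a direct sum. -/
def fst (X Y : PSpace k S) : X.directSum Y ⟶ X :=
  mkHom (LinearMap.fst k _ _) fun _ _ hx => hx.1

/-- The second projection from a direct sum. -/
def snd (X Y : PSpace k S) : X.directSum Y ⟶ Y :=
  mkHom (LinearMap.snd k _ _) fun _ _ hx => hx.2

theorem inl_fst (X Y : PSpace k S) : inl X Y ≫ fst X Y = 𝟙 X := rfl

theorem inr_snd (X Y : PSpace k S) : inr X Y ≫ snd X Y = 𝟙 Y := rfl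

theorem fst_inl_add_snd_inr (X Y : PSpace k S) :
    fst X Y ≫ inl X Y + snd X Y ≫ inr X Y = 𝟙 (X.directSum Y) :=
  hom_ext (LinearMap.ext fun x => Prod.ext (add_zero x.1) (zero_add x.2))

/-- The space on a subspace of the ambient space, with the induced subspaces. -/
def ofSubmodule (V : PSpace k S) (M : Submodule k V.carrier) : PSpace k S where
  carrier := M
  sub s := (V.sub s).comap M.subtype
  mono _ _ h := Submodule.comap_mono (V.mono h)

/-- The complement is the kernel, through `x ↦ (e x, x - e x)`; both components respect the
subspaces because `e` does. -/
theorem isDirectSummand_range {V : PSpace k S} (e : V ⟶ V) (he : e ≫ e = e) :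
    (V.ofSubmodule (LinearMap.range (lin e))).IsDirectSummand V := by
  have he' : ∀ x, lin e (lin e x) = lin e x := fun x => lin_congr he x
  refine ⟨V.ofSubmodule (LinearMap.ker (lin e)), ⟨?_⟩⟩
  refine
    { hom := mkHom (LinearMap.prod (lin e).rangeRestrict
        ((LinearMap.id - lin e).codRestrict _ fun x => by simp [he'])) ?_
      inv := mkHom (LinearMap.coprod (LinearMap.range (lin e)).subtype
        (LinearMap.ker (lin e)).subtype) ?_
      hom_inv_id := ?_
      inv_hom_id := ?_ }
  · exact fun s x hx => ⟨lin_mem e hx, Submodule.sub_mem _ hx (lin_mem e hx)⟩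
  · exact fun s x hx => Submodule.add_mem _ hx.1 hx.2
  · exact hom_ext_apply fun x => add_sub_cancel (lin e x) x
  · refine hom_ext_apply fun x => ?_
    obtain ⟨⟨_, ⟨y, rfl⟩⟩, ⟨z, hz⟩⟩ := x
    rw [LinearMap.mem_ker] at hz
    refine Prod.ext (Subtype.ext ?_) (Subtype.ext ?_)
    · change lin e (lin e y + z) = lin e y
      rw [map_add, he', hz, add_zero]
    · change lin e y + z - lin e (lin e y + z) = z
      rw [map_add, he', hz, add_zero, add_sub_cancel_left]

/-- Summands are the images of idempotents, and such an image is full at `p` exactly when it lies in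
`V(p)`. -/
theorem noFullSummand_iff_idempotent {V : PSpace k S} {p : S} :
    noFullSummand p V ↔ ∀ e : V ⟶ V, e ≫ e = e → LinearMap.range (lin e) ≤ V.sub p → e = 0 := by
  constructor
  · intro h e he hle
    have hz := (isZero_iff _).1 (h _ (isDirectSummand_range e he)
      (Submodule.eq_top_iff'.2 fun x => hle x.2))
    exact hom_ext_apply fun x => congrArg Subtype.val
      (hz.elim (⟨lin e x, x, rfl⟩ : LinearMap.range (lin e)) 0)
  · rintro h X ⟨Y, ⟨φ⟩⟩ hX
    have h0 := h (φ.hom ≫ (fst X Y ≫ inl X Y) ≫ φ.inv) (by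
      simp only [Category.assoc, Iso.inv_hom_id_assoc]
      rw [← Category.assoc (inl X Y), inl_fst, Category.id_comp]) (by
      rintro _ ⟨x, rfl⟩
      refine lin_mem φ.inv ⟨?_, Submodule.zero_mem _⟩
      have hX' : X.sub p = ⊤ := hX
      rw [hX']
      exact Submodule.mem_top)
    rw [Limits.IsZero.iff_id_eq_zero]
    calc 𝟙 X = inl X Y ≫ φ.inv ≫ (φ.hom ≫ (fst X Y ≫ inl X Y) ≫ φ.inv) ≫ φ.hom ≫ fst X Y := by
          simp only [Category.assoc, Iso.inv_hom_id_assoc]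
          rw [inl_fst, Category.comp_id, inl_fst]
      _ = 0 := by rw [h0]; simp

/-! ### Polynomials in an endomorphism, Fitting's lemma and projective covers -/

theorem aeval_mem {V : PSpace k S} (e : V ⟶ V) (q : Polynomial k) {s : S} {x : V.carrier}
    (hx : x ∈ V.sub s) : Polynomial.aeval (R := k) (A := Module.End k V.carrier) (lin e) q x ∈
      V.sub s := by
  induction q using Polynomial.induction_on' with
  | add p q hp hq =>
    rw [map_add, LinearMap.add_apply]
    exact Submodule.add_mem _ hp hq
  | monomial n a =>
    rw [Polynomial.aeval_monomial, Module.End.mul_apply, Module.algebraMap_end_apply]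
    refine Submodule.smul_mem _ _ ?_
    induction n with
    | zero => simpa using hx
    | succ n ih =>
      rw [pow_succ', Module.End.mul_apply]
      exact lin_mem e ih

/-- The value of a polynomial at an endomorphism. -/
noncomputable def polyHom {V : PSpace k S} (e : V ⟶ V) (q : Polynomial k) : V ⟶ V :=
  mkHom (Polynomial.aeval (R := k) (A := Module.End k V.carrier) (lin e) q)
    fun _ _ hx => aeval_mem e q hx

theorem polyHom_mul {V : PSpace k S} (e : V ⟶ V) (q r : Polynomial k) :
    polyHom e (q * r) = polyHom e r ≫ polyHom e q :=
  hom_ext (map_mul (Polynomial.aeval (R := k) (A := Module.End k V.carrier) (lin e)) q r)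

theorem polyHom_add {V : PSpace k S} (e : V ⟶ V) (q r : Polynomial k) :
    polyHom e (q + r) = polyHom e q + polyHom e r :=
  hom_ext (map_add (Polynomial.aeval (R := k) (A := Module.End k V.carrier) (lin e)) q r)

theorem polyHom_one {V : PSpace k S} (e : V ⟶ V) : polyHom e 1 = 𝟙 V :=
  hom_ext (map_one (Polynomial.aeval (R := k) (A := Module.End k V.carrier) (lin e)))

theorem polyHom_X {V : PSpace k S} (e : V ⟶ V) : polyHom e Polynomial.X = e :=
  hom_ext (Polynomial.aeval_X (R := k) (A := Module.End k V.carrier) (lin e))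

/-- Fitting's lemma: the identity is the sum of an idempotent killed by a power of `e` and of a
multiple of `e`. -/
theorem exists_fitting_idempotent {V : PSpace k S} (e : V ⟶ V) :
    ∃ (u v : V ⟶ V) (n : ℕ), u ≫ u = u ∧ u + v ≫ e = 𝟙 V ∧
      u ≫ polyHom e (Polynomial.X ^ n) = 0 := by
  have hm : minpoly k (lin e : Module.End k V.carrier) ≠ 0 :=
    minpoly.ne_zero (Algebra.IsIntegral.isIntegral _)
  obtain ⟨q, hq, hndvd⟩ := Polynomial.exists_eq_pow_rootMultiplicity_mul_and_not_dvd _ hm 0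
  rw [Polynomial.C_0, sub_zero] at hq hndvd
  generalize Polynomial.rootMultiplicity 0
    (minpoly k (lin e : Module.End k V.carrier)) = n at hq
  -- The minimal polynomial is `X ^ n * q` with `q` prime to `X`. The exponent `n + 1` is positive
  -- even if `n = 0`, so that a factor `e` can be split off below.
  have hcop : IsCoprime (Polynomial.X ^ (n + 1)) q :=
    IsCoprime.pow_left ((Polynomial.irreducible_X.coprime_iff_not_dvd).2 hndvd)
  obtain ⟨a, b, hab⟩ := hcop
  have hz : polyHom e (Polynomial.X ^ (n + 1) * q) = 0 := by
    refine hom_ext ?_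
    change Polynomial.aeval (lin e : Module.End k V.carrier) _ = 0
    rw [pow_succ', mul_assoc, ← hq, map_mul, minpoly.aeval, mul_zero]
  have hXu : polyHom e (b * q) ≫ polyHom e (Polynomial.X ^ (n + 1)) = 0 := by
    rw [← polyHom_mul, show Polynomial.X ^ (n + 1) * (b * q) =
      b * (Polynomial.X ^ (n + 1) * q) by ring, polyHom_mul, hz, Limits.zero_comp]
  have hsum : polyHom e (b * q) + polyHom e (Polynomial.X ^ (n + 1)) ≫ polyHom e a = 𝟙 V := by
    rw [← polyHom_mul, ← polyHom_add, add_comm, hab, polyHom_one]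
  refine ⟨polyHom e (b * q), polyHom e (Polynomial.X ^ n * a), n + 1, ?_, ?_, hXu⟩
  · have := congrArg (polyHom e (b * q) ≫ ·) hsum
    simpa [Preadditive.comp_add, ← Category.assoc, hXu] using this
  · rw [← hsum]
    congr 1
    calc polyHom e (Polynomial.X ^ n * a) ≫ e
        = polyHom e (Polynomial.X ^ n * a) ≫ polyHom e Polynomial.X := by rw [polyHom_X]
      _ = polyHom e (Polynomial.X ^ (n + 1)) ≫ polyHom e a := by
        rw [← polyHom_mul, ← polyHom_mul]
        congr 1
        ring

theorem polyHom_X_pow_comp {V W : PSpace k S} {e : V ⟶ V} {f : V ⟶ W} (h : e ≫ f = f) (n : ℕ) :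
    polyHom e (Polynomial.X ^ n) ≫ f = f := by
  induction n with
  | zero => rw [pow_zero, polyHom_one, Category.id_comp]
  | succ n ih => rw [pow_succ, polyHom_mul, Category.assoc, ih, polyHom_X, h]

/-- A proper epimorphism from a projective space is a projective cover if and only if its kernel
contains the range of no nonzero idempotent. -/
theorem isProjectiveCover_iff {P V : PSpace k S} (hP : P.IsProjective) {f : P ⟶ V}
    (hf : IsProperEpi f) :
    IsProjectiveCover f ↔ ∀ e : P ⟶ P, e ≫ e = e → e ≫ f = 0 → e = 0 := by
  constructor
  · rintro ⟨-, -, hess⟩ e he hef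
    -- As `e` is killed by `f`, composing `1 - e` with `f` gives `f` again. So `1 - e` is an
    -- epimorphism, and it annihilates `e`.
    have h1 : IsProperEpi (𝟙 P - e) := (hess P _).2 (by
      rwa [Preadditive.sub_comp, hef, sub_zero, Category.id_comp])
    have := h1.1
    rw [← cancel_epi (𝟙 P - e), Preadditive.sub_comp, he, Category.id_comp, sub_self,
      Limits.comp_zero]
  · refine fun h => ⟨hP, hf.1, fun X g => ⟨fun hg => hg.comp hf, fun hgf => ?_⟩⟩
    -- The endomorphism `l ≫ g` of `P` fixes `f`. Its Fitting idempotent `u` is then killed by `f`,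
    -- hence zero, and `g` becomes a split epimorphism.
    obtain ⟨l, hl⟩ := hP _ _ _ hgf f
    rw [← Category.assoc] at hl
    obtain ⟨u, v, n, huu, huv, hun⟩ := exists_fitting_idempotent (l ≫ g)
    have hu : u = 0 := h u huu <| by
      rw [← polyHom_X_pow_comp hl n, ← Category.assoc, hun, Limits.zero_comp]
    rw [hu, zero_add, ← Category.assoc] at huv
    exact IsProperEpi.of_comp_id huv

end General

/-! ### Induction, coinduction, and kernels and cokernels at `p` -/

section Functors

variable {k : Type u} [Field k] {S : Type v} [PartialOrder S] {T : Type w} [PartialOrder T]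

theorem mem_coind {e : T ↪o S} {V : PSpace k T} {s : S} {x : V.carrier} :
    x ∈ ((coind e).obj V).sub s ↔ ∀ t, s ≤ e t → x ∈ V.sub t := by
  change x ∈ (⨅ (t : T) (_ : s ≤ e t), V.sub t) ↔ _
  simp only [Submodule.mem_iInf]

theorem mem_coind_emb {e : T ↪o S} {V : PSpace k T} {t : T} {x : V.carrier} :
    x ∈ ((coind e).obj V).sub (e t) ↔ x ∈ V.sub t :=
  mem_coind.trans ⟨fun h => h t le_rfl, fun h _ ht => V.mono (e.le_iff_le.1 ht) h⟩

theorem ind_sub_emb {e : T ↪o S} {V : PSpace k T} (t : T) :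
    ((ind e).obj V).sub (e t) = V.sub t :=
  le_antisymm (iSup₂_le fun _ ht => V.mono (e.le_iff_le.1 ht))
    (le_iSup₂ (f := fun (t' : T) (_ : e t' ≤ e t) => V.sub t') t le_rfl)

theorem ind_sub_eq_bot {e : T ↪o S} {V : PSpace k T} {s : S} (hs : ∀ t, ¬ e t ≤ s) :
    ((ind e).obj V).sub s = ⊥ :=
  le_bot_iff.1 (iSup₂_le fun t ht => (hs t ht).elim)

/-- Coinduction followed by restriction is the identity. -/
def resCoindIso (e : T ↪o S) (V : PSpace k T) : (res e).obj ((coind e).obj V) ≅ V :=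
  isoOfEquiv (LinearEquiv.refl k V.carrier) fun _ _ => mem_coind_emb

/-- A space whose subspaces are determined by those at `T` is coinduced from `T`. -/
def coindResIso (e : T ↪o S) (V : PSpace k S)
    (hV : ∀ s x, (∀ t, s ≤ e t → x ∈ V.sub (e t)) → x ∈ V.sub s) :
    V ≅ (coind e).obj ((res e).obj V) :=
  isoOfEquiv (LinearEquiv.refl k V.carrier) fun s x =>
    Iff.trans ⟨fun h _ ht => V.mono ht h, hV s x⟩ (mem_coind (V := (res e).obj V)).symm

theorem kappa_comp {p : S} {V W : PSpace k S} {f : V ⟶ W} (hker : LinearMap.ker (lin f) = V.sub p) :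
    kappa p V ≫ f = 0 :=
  hom_ext_apply fun x => LinearMap.mem_ker.1 (hker.ge x.2)

theorem nonempty_isLimit_kappa {p : S} {V W : PSpace k S} {f : V ⟶ W}
    (hker : LinearMap.ker (lin f) = V.sub p) :
    Nonempty (Limits.IsLimit (Limits.KernelFork.ofι (kappa p V) (kappa_comp hker))) :=
  ⟨Limits.KernelFork.IsLimit.ofι _ _
    (fun g hg => mkHom ((lin g).codRestrict (V.sub p) fun x =>
      hker ▸ LinearMap.mem_ker.2 (lin_congr hg x)) fun _ _ hx => lin_mem g hx)
    (fun _ _ => rfl)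
    (fun _ _ _ hm => hom_ext_apply fun x => Subtype.ext (lin_congr hm x))⟩

theorem nonempty_isColimit_kappa {p : S} {V W : PSpace k S} {f : V ⟶ W} (hf : IsProperEpi f)
    (hker : LinearMap.ker (lin f) = V.sub p) :
    Nonempty (Limits.IsColimit (Limits.CokernelCofork.ofπ f (kappa_comp hker))) := by
  have := hf.1
  rw [isProperEpi_iff] at hf
  -- The section `σ` is only linear. Still, `g ∘ σ` respects the subspaces: properness lifts an
  -- element of `W(s)` to `V(s)`, and `g` does not depend on the lift.
  obtain ⟨σ, hσ⟩ := (lin f).exists_rightInverse_of_surjective (LinearMap.range_eq_top.2 hf.1)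
  have hdesc : ∀ {X : PSpace k S} (g : V ⟶ X), kappa p V ≫ g = 0 → ∀ x,
      lin g (σ (lin f x)) = lin g x := by
    intro X g hg x
    have hx : σ (lin f x) - x ∈ V.sub p := by
      rw [← hker, LinearMap.mem_ker, map_sub, sub_eq_zero]
      exact LinearMap.congr_fun hσ _
    rw [← sub_eq_zero, ← map_sub]
    exact lin_congr hg ⟨_, hx⟩
  refine ⟨Limits.CokernelCofork.IsColimit.ofπ _ _
    (fun {X} g hg => mkHom (lin g ∘ₗ σ) fun s y hy => ?_)
    (fun g hg => hom_ext_apply fun x => hdesc g hg x)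
    (fun g hg m hm => ?_)⟩
  · obtain ⟨x, hx, rfl⟩ := hf.2 s y hy
    exact (hdesc g hg x).symm ▸ lin_mem g hx
  · rw [← cancel_epi f, hm]
    exact (hom_ext_apply fun x => hdesc g hg x).symm

/-- A proper epimorphism with kernel `V p` is the projection to `E_p V`. -/
noncomputable def ESubIso {p : S} {V W : PSpace k S} {f : V ⟶ W} (hf : IsProperEpi f)
    (hker : LinearMap.ker (lin f) = V.sub p) : (ESub p).obj V ≅ W :=
  isoOfEquiv ((Submodule.quotEquivOfEq _ _ hker.symm).trans
      ((lin f).quotKerEquivOfSurjective (isProperEpi_iff.1 hf).1)) fun s x => by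
    obtain ⟨x, rfl⟩ := Submodule.Quotient.mk_surjective _ x
    change Submodule.Quotient.mk x ∈ (V.sub s).map (V.sub p).mkQ ↔ lin f x ∈ W.sub s
    constructor
    · rintro ⟨y, hy, hyx⟩
      have : y - x ∈ LinearMap.ker (lin f) := hker ▸ (Submodule.Quotient.eq _).1 hyx
      rw [LinearMap.mem_ker, map_sub, sub_eq_zero] at this
      exact this ▸ lin_mem f hy
    · intro hx
      obtain ⟨y, hy, hyx⟩ := (isProperEpi_iff.1 hf).2 s _ hx
      refine ⟨y, hy, (Submodule.Quotient.eq _).2 ?_⟩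
      rw [← hker, LinearMap.mem_ker, map_sub, hyx, sub_self]

/-- The space `E^p V` is itself full at `p`, and any `α` with image in `V(p)` factors through it. -/
theorem factorsThroughFullAt_iff {U V : PSpace k S} (α : U ⟶ V) (p : S) :
    FactorsThroughFullAt α p ↔ ∀ x, lin α x ∈ V.sub p := by
  constructor
  · rintro ⟨X, hX, γ, β, rfl⟩ x
    have hX' : X.sub p = ⊤ := hX
    exact lin_mem β (hX' ▸ Submodule.mem_top)
  · intro h
    exact ⟨(ESup p).obj V, Submodule.eq_top_iff'.2 fun x => x.2,
      mkHom ((lin α).codRestrict _ h) fun _ _ hx => lin_mem α hx, kappa p V, rfl⟩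

end Functors

/-! ### The enlarged poset and the functor `D` -/

section Enlargement

variable {k : Type u} [Field k] {S : Type v} [PartialOrder S] {R : Set S}

theorem ptEmb_coe (p : R) : Enl.ptEmb R p = Enl.pt p :=
  dif_pos p.2

theorem ptEmb_of_notMem {s : S} (hs : s ∉ R) :
    Enl.ptEmb R s = Enl.ac (AHat.single ⟨s, hs⟩) :=
  dif_neg hs

theorem mem_coind_pt {V : PSpace k S} {p : R} {x : V.carrier} :
    x ∈ ((coind (Enl.ptEmb R)).obj V).sub (Enl.pt p) ↔ x ∈ V.sub p := by
  rw [← ptEmb_coe]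
  exact mem_coind_emb

/-- A nonempty antichain is the meet of its elements. -/
theorem isGLB_single (A : AHat S) : IsGLB (AHat.single '' A.carrier) A := by
  constructor
  · rintro _ ⟨a, ha, rfl⟩ b hb
    exact ⟨a, ha, (Set.mem_singleton_iff.1 hb).ge⟩
  · intro B hB a ha
    exact hB ⟨a, ha, rfl⟩ a rfl

instance instFiniteAHat [Finite S] : Finite (AHat S) :=
  Finite.of_injective AHat.carrier fun _ _ => AHat.ext

/-- Coinduction leaves the subspace at `p` unchanged, and the map induced on `U / U(p)` with values
in `V / V(p)` vanishes exactly when the image of `α` lies in `V(p)`. -/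
theorem diffFunctor_map_eq_zero_iff (F : Set (Enl R)) (p : R) {U V : PSpace k S} (α : U ⟶ V) :
    (diffFunctor k F p).map α = 0 ↔ FactorsThroughFullAt α (p : S) := by
  rw [factorsThroughFullAt_iff]
  constructor
  · intro h x
    exact mem_coind_pt.1 ((Submodule.Quotient.mk_eq_zero _).1 (lin_congr h (Submodule.Quotient.mk x)))
  · intro h
    exact hom_ext (Submodule.linearMap_qext _ (LinearMap.ext fun x =>
      (Submodule.Quotient.mk_eq_zero _).2 (mem_coind_pt.2 (h x))))

theorem additive_diffFunctor (F : Set (Enl R)) (p : R) : (diffFunctor k F p).Additive where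
  map_add := hom_ext (Submodule.linearMap_qext _ rfl)

/-- Removing the direct summands full at `p` does not change the image under `diffFunctor`. -/
theorem exists_noFullSummand_iso (F : Set (Enl R)) (p : R) (V : PSpace k S) :
    ∃ V' : PSpace k S, noFullSummand (p : S) V' ∧
      Nonempty ((diffFunctor k F p).obj V' ≅ (diffFunctor k F p).obj V) := by
  have := additive_diffFunctor (k := k) F p
  induction hn : Module.finrank k V.carrier using Nat.strong_induction_on generalizing V with
  | _ n ih =>
    by_cases hV : noFullSummand (p : S) V
    · exact ⟨V, hV, ⟨Iso.refl _⟩⟩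
    simp only [noFullSummand, not_forall] at hV
    obtain ⟨X, ⟨Y, ⟨φ⟩⟩, hX, hX0⟩ := hV
    rw [isZero_iff, not_subsingleton_iff_nontrivial] at hX0
    have hlt : Module.finrank k Y.carrier < n := by
      let ψ : V.carrier ≃ₗ[k] X.carrier × Y.carrier :=
        LinearEquiv.ofLinearMap (lin φ.hom) (lin φ.inv) (congrArg lin φ.inv_hom_id)
          (congrArg lin φ.hom_inv_id)
      have h1 := ψ.finrank_eq
      rw [Module.finrank_prod] at h1
      have h2 : 0 < Module.finrank k X.carrier := Module.finrank_pos
      lia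
    obtain ⟨V', hV', ⟨ψ⟩⟩ := ih _ hlt Y rfl
    -- The projector onto `X` factors through `X`, so `D` kills it; by additivity, the projector
    -- onto `Y` becomes the identity.
    have h0 : (diffFunctor k F p).map (fst X Y ≫ inl X Y) = 0 :=
      (diffFunctor_map_eq_zero_iff F p _).2 ⟨X, hX, _, _, rfl⟩
    have hYD : (diffFunctor k F p).obj Y ≅ (diffFunctor k F p).obj (X.directSum Y) :=
      { hom := (diffFunctor k F p).map (inr X Y)
        inv := (diffFunctor k F p).map (snd X Y)
        hom_inv_id := by rw [← CategoryTheory.Functor.map_comp, inr_snd, CategoryTheory.Functor.map_id]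
        inv_hom_id := by
          rw [← CategoryTheory.Functor.map_comp, ← CategoryTheory.Functor.map_id, ← fst_inl_add_snd_inr, CategoryTheory.Functor.map_add, h0,
            zero_add] }
    exact ⟨V', hV', ⟨ψ ≪≫ hYD ≪≫ (diffFunctor k F p).mapIso φ.symm⟩⟩

/-! ### The lifted space: its kernel, coinduction and idempotents -/

section Lift

variable (hR : IsUpperSet R) {P : PSpace k (AHat (Rᶜ : Set S))} {V : PSpace k (Enl R)}
  (f : P ⟶ (res (Enl.acEmb R)).obj V)

/-- The morphism from `liftSpace hR f` with the linear map of `f`. -/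
def liftHom : liftSpace hR f ⟶ V :=
  mkHom (U := liftSpace hR f) (lin (U := P) f) fun s x hx => by
    cases s with
    | pt r => exact hx
    | ac A => exact lin_mem (U := P) f hx

variable {f}

theorem isProperEpi_liftHom (hf : IsProperEpi f) : IsProperEpi (liftHom hR f) := by
  rw [isProperEpi_iff] at hf ⊢
  refine ⟨hf.1, fun s y hy => ?_⟩
  cases s with
  | pt r =>
    obtain ⟨x, rfl⟩ := hf.1 y
    exact ⟨x, hy, rfl⟩
  | ac A => exact hf.2 A y hy

theorem ker_liftHom {p : R} (hp : V.sub (Enl.pt p) = ⊥) :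
    LinearMap.ker (lin (liftHom hR f)) = (liftSpace hR f).sub (Enl.pt p) := by
  change _ = (V.sub (Enl.pt p)).comap (lin (liftHom hR f))
  rw [hp]
  exact (Submodule.comap_bot _).symm

/-- This makes the lifted space coinduced from `S`. At a point of `R` it is immediate; at an
antichain it is the meet property of the projective `P`. -/
theorem mem_liftSpace_of_forall_le [Finite S] (hP : P.IsProjective) (q : Enl R)
    (x : P.carrier) (hx : ∀ s, q ≤ Enl.ptEmb R s → x ∈ (liftSpace hR f).sub (Enl.ptEmb R s)) :
    x ∈ (liftSpace hR f).sub q := by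
  cases q with
  | pt r =>
    rw [← ptEmb_coe]
    exact hx r (ptEmb_coe r).ge
  | ac A =>
    refine hP.mem_sub_of_isGLB (A.nonempty.image _) (isGLB_single A) (x := x) ?_
    rintro _ ⟨a, ha, rfl⟩
    have h := hx a
    rw [ptEmb_of_notMem a.2] at h
    exact h ((Enl.acEmb R).monotone ((isGLB_single A).1 ⟨a, ha, rfl⟩))

theorem isProjectiveCover_iff_noFullSummand [Finite S] (hP : P.IsProjective) (hf : IsProperEpi f)
    {p : R} (hp : V.sub (Enl.pt p) = ⊥) :
    IsProjectiveCover f ↔ noFullSummand (p : S) ((res (Enl.ptEmb R)).obj (liftSpace hR f)) := by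
  rw [isProjectiveCover_iff hP hf, noFullSummand_iff_idempotent]
  have hsub : ((res (Enl.ptEmb R)).obj (liftSpace hR f)).sub p = LinearMap.ker (lin f) := by
    change (liftSpace hR f).sub (Enl.ptEmb R p) = _
    rw [ptEmb_coe]
    exact (ker_liftHom hR hp).symm
  constructor
  · intro h e he hle
    rw [hsub] at hle
    -- An endomorphism over `S` respects the subspaces at antichains too, since these are
    -- intersections of subspaces at points.
    let e' : P ⟶ P := mkHom (lin (U := (res (Enl.ptEmb R)).obj (liftSpace hR f)) e) fun A x hx => by
      refine mem_liftSpace_of_forall_le hR (f := f) hP (Enl.ac A) _ fun s hs => ?_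
      exact lin_mem e (s := s) ((liftSpace hR f).mono hs hx)
    have he' : e' = 0 := h e' (hom_ext_apply fun x => lin_congr he x)
      (hom_ext_apply fun x => LinearMap.mem_ker.1 (hle ⟨x, rfl⟩))
    exact hom_ext_apply fun x => lin_congr he' x
  · intro h e he hef
    have hker : ∀ x, lin f (lin e x) = 0 := fun x => lin_congr hef x
    -- At points of `R` nothing is required of `e`: its image lies in the kernel of `f`, hence in
    -- every inverse image under `f`.
    let g : liftSpace hR f ⟶ liftSpace hR f := mkHom (lin (U := P) (V := P) e) fun q x hx => by
      cases q with
      | pt r =>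
        have h0 : ∀ y : V.carrier, y = 0 → y ∈ V.sub (Enl.pt r) := fun y hy =>
          hy ▸ Submodule.zero_mem _
        exact h0 _ (hker x)
      | ac A => exact lin_mem (U := P) (V := P) e hx
    have hg := h ((res (Enl.ptEmb R)).map g) (hom_ext_apply fun x => lin_congr he x) (by
      rw [hsub]
      rintro _ ⟨x, rfl⟩
      exact hker x)
    exact hom_ext_apply fun x => lin_congr hg x

end Lift

theorem ind_incl_sub_eq_bot {F : Set (Enl R)} (hF : IsUpperSet F) {p : R} (hp : Enl.pt p ∉ F)
    (W : PSpace k F) : ((ind (incl F)).obj W).sub (Enl.pt p) = ⊥ :=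
  ind_sub_eq_bot fun t ht => hp (hF ht t.2)

theorem nonempty_iso_diffFunctor (hR : IsUpperSet R) {F : Set (Enl R)} (hF : IsUpperSet F) {p : R}
    (hp : Enl.pt p ∉ F) {W : PSpace k F} {P : PSpace k (AHat (Rᶜ : Set S))}
    {f : P ⟶ (res (Enl.acEmb R)).obj ((ind (incl F)).obj W)} (hf : IsProperEpi f)
    {V : PSpace k S} (φ : liftSpace hR f ≅ (coind (Enl.ptEmb R)).obj V) :
    Nonempty (W ≅ (diffFunctor k F p).obj V) := by
  let ψ : (res (incl F)).obj ((ind (incl F)).obj W) ≅ W :=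
    isoOfEquiv (LinearEquiv.refl k W.carrier) fun t x => by
      change x ∈ ((ind (incl F)).obj W).sub (incl F t) ↔ x ∈ W.sub t
      rw [ind_sub_emb]
      rfl
  let χ := ESubIso (isProperEpi_liftHom hR hf) (ker_liftHom hR (ind_incl_sub_eq_bot hF hp W))
  exact ⟨ψ.symm ≪≫ (res (incl F)).mapIso (χ.symm ≪≫ (ESub (Enl.pt p)).mapIso φ)⟩

end Enlargement

end PosetRep.PSpace

theorem proposition5p5 {k : Type u} [Field k] {S : Type v} [PartialOrder S] [Finite S]
    (R : Set S) (hR : IsUpperSet R) (hw : width (Rᶜ : Set S) ≤ 2)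
    (F : Set (Enl R)) (hF : IsUpperSet F) (p : R) (hp : Enl.pt p ∉ F) :
    -- Statements about a proper epimorphism `f : P ⟶ res ind W` with `P` projective.
    (∀ (W : PSpace k F) (P : PSpace k (AHat (Rᶜ : Set S)))
        (f : P ⟶ (res (Enl.acEmb R)).obj ((ind (incl F)).obj W)),
      P.IsProjective → IsProperEpi f →
        -- (a)
        (∃ fhat : liftSpace hR f ⟶ (ind (incl F)).obj W,
          lin fhat = lin f ∧ IsProperEpi fhat ∧
          (res (Enl.acEmb R)).obj (liftSpace hR f) = P ∧
          (res (Enl.acEmb R)).map fhat = f ∧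
          ∃ hκ : kappa (Enl.pt p) (liftSpace hR f) ≫ fhat = 0,
            LinearMap.ker (lin fhat) = (liftSpace hR f).sub (Enl.pt p) ∧
            Nonempty (Limits.IsLimit
              (Limits.KernelFork.ofι (kappa (Enl.pt p) (liftSpace hR f)) hκ)) ∧
            Nonempty (Limits.IsColimit (Limits.CokernelCofork.ofπ fhat hκ))) ∧
        -- existence and uniqueness of `V`
        (∃ V : PSpace k S, Nonempty (liftSpace hR f ≅ (coind (Enl.ptEmb R)).obj V) ∧
          ∀ V' : PSpace k S, Nonempty (liftSpace hR f ≅ (coind (Enl.ptEmb R)).obj V') →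
            Nonempty (V' ≅ V)) ∧
        (∀ V : PSpace k S, Nonempty (liftSpace hR f ≅ (coind (Enl.ptEmb R)).obj V) →
          -- (b)
          Nonempty (W ≅ (diffFunctor k F p).obj V) ∧
          -- (d), first part
          (IsProjectiveCover f ↔ noFullSummand (p : S) V))) ∧
    -- (c)
    (∀ (U V : PSpace k S) (α : U ⟶ V),
      (diffFunctor k F p).map α = 0 ↔ FactorsThroughFullAt α (p : S)) ∧
    -- (d), second part
    (diffFunctor k F p).Additive ∧
    ((noFullSummand (k := k) (p : S)).ι ⋙ diffFunctor k F p).EssSurj := by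
  have hbot := fun W : PSpace k F => ind_incl_sub_eq_bot hF hp W
  have := additive_diffFunctor (k := k) F p
  refine ⟨fun W P f hP hf => ⟨?_, ?_, ?_⟩, fun U V α => diffFunctor_map_eq_zero_iff F p α,
    this, ⟨fun W => ?_⟩⟩
  · have hker := ker_liftHom hR (f := f) (hbot W)
    have hlift := isProperEpi_liftHom hR hf
    exact ⟨liftHom hR f, rfl, hlift, rfl, rfl, kappa_comp hker, hker,
      nonempty_isLimit_kappa hker, nonempty_isColimit_kappa hlift hker⟩
  · refine ⟨(res (Enl.ptEmb R)).obj (liftSpace hR f),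
      ⟨coindResIso _ _ (mem_liftSpace_of_forall_le hR hP)⟩, ?_⟩
    rintro V' ⟨φ⟩
    -- Any such `V'` is recovered from its coinduced space by restriction to `S`.
    exact ⟨(resCoindIso _ V').symm ≪≫ (res (Enl.ptEmb R)).mapIso φ.symm⟩
  · rintro V ⟨φ⟩
    refine ⟨nonempty_iso_diffFunctor hR hF hp hf φ, ?_⟩
    rw [isProjectiveCover_iff_noFullSummand hR hP hf (hbot W)]
    exact noFullSummand_congr ((res (Enl.ptEmb R)).mapIso φ ≪≫ resCoindIso _ V) _
  -- A free cover need not be a projective cover, so the resulting `S`-space may have summands full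
  -- at `p`; these are removed afterwards.
  · obtain ⟨P, f, hP, hf⟩ := exists_projective_properEpi
      ((res (Enl.acEmb R)).obj ((ind (incl F)).obj W))
    obtain ⟨φ⟩ := nonempty_iso_diffFunctor hR hF hp hf
      (coindResIso (Enl.ptEmb R) _ (mem_liftSpace_of_forall_le hR hP))
    obtain ⟨V', hV', ⟨ψ⟩⟩ := exists_noFullSummand_iso F p
      ((res (Enl.ptEmb R)).obj (liftSpace hR f))
    exact ⟨⟨V', hV'⟩, ⟨ψ ≪≫ φ.symm⟩⟩
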